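/- Let $W=\{W(s,t);\ s,t\ge 0\}$ be a (real-valued, two-parameter) Brownian sheet on a probability space $(\Omega,\mathcal{M},\mathrm{P})$, i.e., a centered Gaussian process with a.s. continuous paths and covariance $\mathrm{E}[W(s,t)W(s',t')]=\min(s,s')\min(t,t')$. For $s\ge 0$ let $\mathfrak{F}_{00}(s)$ be the $\sigma$-algebra generated by $\{W(r,t);\ r\in[0,s],\ t\ge 0\}$, let $\mathfrak{F}_0(s)$ be the $\sigma$-algebra obtained from it by adding all $\mathrm{P}$-null sets, and let $\mathfrak{F}(s):=\bigcap_{u>s}\mathfrak{F}_0(u)$. Let $S:\Omega\to[0,\infty)$ be a finite $\mathfrak{F}$-stopping time. Then the germ $\sigma$-algebra of the function-valued process $s\mapsto W(S+s,\bullet)-W(S,\bullet)$ at $s=0^+$, $$\bigcap_{\delta\in\mathbb{Q},\,\delta>0}\sigma\Big\{W(S+u,\bullet)-W(S,\bullet);\ u\in[0,\delta)\Big\},$$ is trivial: each of its elements either is $\mathrm{P}$-null or has a $\mathrm{P}$-null complement. Here, for each $u$, the random function $W(S+u,\bullet)-W(S,\bullet)$ is indexed by $t\in[0,\infty)$. In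 particular, the same holds for the $\sigma$-algebra $$\bigcap_{s\in\mathbb{Q},\,s>0}\sigma\Big\{W(S+s,\bullet)-W(S,\bullet)\Big\}.$$ -/

import Mathlib

open MeasureTheory ProbabilityTheory
open scoped NNReal

/-- `W : ℝ≥0 → ℝ≥0 → Ω → ℝ` is a (standard, real-valued, two-parameter) Brownian sheet under `P`:
a centred Gaussian process indexed by `(s, t) ∈ [0, ∞)²`, with covariance
`E[W(s, t) W(s', t')] = min(s, s') * min(t, t')`, and with almost surely continuous paths.
(That `P` is a probability measure is part of `IsGaussianProcess`.) -/
structure IsBrownianSheet {Ω : Type*} {mΩ : MeasurableSpace Ω}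
    (W : ℝ≥0 → ℝ≥0 → Ω → ℝ) (P : Measure Ω) : Prop where
  isGaussianProcess : IsGaussianProcess (fun p : ℝ≥0 × ℝ≥0 => W p.1 p.2) P
  integral_eq_zero : ∀ s t, ∫ ω, W s t ω ∂P = 0
  covariance_eq : ∀ s t s' t', cov[W s t, W s' t'; P] = (min s s' : ℝ) * (min t t' : ℝ)
  continuous_paths : ∀ᵐ ω ∂P, Continuous (fun p : ℝ≥0 × ℝ≥0 => W p.1 p.2 ω)

namespace IsBrownianSheet

variable {Ω : Type*} {mΩ : MeasurableSpace Ω} {P : Measure Ω}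

/-- The σ-algebra `𝔉₀₀(s)` generated by the random variables `W(r, t)`, `r ∈ [0, s]`, `t ≥ 0`. -/
def rawSigmaAlgebra (W : ℝ≥0 → ℝ≥0 → Ω → ℝ) (s : ℝ≥0) : MeasurableSpace Ω :=
  ⨆ (r : ℝ≥0) (_ : r ≤ s) (t : ℝ≥0), MeasurableSpace.comap (W r t) (borel ℝ)

/-- The σ-algebra `𝔉₀(s)`, obtained by adding all `P`-null sets to `𝔉₀₀(s)`: it consists of the
sets which agree with a set in `𝔉₀₀(s)` up to a `P`-null set. -/
def completedSigmaAlgebra (W : ℝ≥0 → ℝ≥0 → Ω → ℝ) (P : Measure Ω) (s : ℝ≥0) :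
    MeasurableSpace Ω :=
  eventuallyMeasurableSpace (rawSigmaAlgebra W s) (ae P)

theorem rawSigmaAlgebra_mono (W : ℝ≥0 → ℝ≥0 → Ω → ℝ) : Monotone (rawSigmaAlgebra W) :=
  fun _ _ hij => iSup₂_le fun r hr => le_iSup₂_of_le r (hr.trans hij) le_rfl

theorem completedSigmaAlgebra_mono (W : ℝ≥0 → ℝ≥0 → Ω → ℝ) (P : Measure Ω) :
    Monotone (completedSigmaAlgebra W P) := by
  rintro i j hij A ⟨B, hB, hAB⟩
  exact ⟨B, rawSigmaAlgebra_mono W hij B hB, hAB⟩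

theorem rawSigmaAlgebra_le {W : ℝ≥0 → ℝ≥0 → Ω → ℝ} (hW : IsBrownianSheet W P) (s : ℝ≥0) :
    rawSigmaAlgebra W s ≤ eventuallyMeasurableSpace mΩ (ae P) := by
  refine iSup₂_le fun r _ => iSup_le fun t => ?_
  rintro A ⟨B, hB, rfl⟩
  have hm : AEMeasurable (W r t) P :=
    (hW.isGaussianProcess.hasGaussianLaw_eval (r, t)).aemeasurable
  have hB' : MeasurableSet B := by rwa [BorelSpace.measurable_eq (α := ℝ)]
  exact hm.nullMeasurable hB'

theorem completedSigmaAlgebra_le {W : ℝ≥0 → ℝ≥0 → Ω → ℝ} (hW : IsBrownianSheet W P) (s : ℝ≥0) :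
    completedSigmaAlgebra W P s ≤ eventuallyMeasurableSpace mΩ (ae P) := by
  rintro A ⟨B, hB, hAB⟩
  exact EventuallyMeasurableSet.congr (hW.rawSigmaAlgebra_le s B hB) hAB

/-- The filtration `𝔉` of the Brownian sheet, `𝔉(s) = ⋂_{u > s} 𝔉₀(u)`: the right-continuous
version of the completed filtration generated by `W`. As `𝔉(s)` contains all `P`-null sets, the
ambient σ-algebra is the `P`-completion of that of `Ω`. -/
def filtration {W : ℝ≥0 → ℝ≥0 → Ω → ℝ} (hW : IsBrownianSheet W P) :
    Filtration ℝ≥0 (eventuallyMeasurableSpace mΩ (ae P)) where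
  seq s := ⨅ (u : ℝ≥0) (_ : s < u), completedSigmaAlgebra W P u
  mono' _ _ hij := le_iInf₂ fun u hu => iInf₂_le u (hij.trans_lt hu)
  le' s := (iInf₂_le (s + 1) (lt_add_of_pos_right s one_pos)).trans
    (hW.completedSigmaAlgebra_le (s + 1))

end IsBrownianSheet

section Germ

variable {Ω : Type*}

/-- The random function `W(S + s, •) - W(S, •)` on `[0, ∞)`. -/
def sheetIncrement (W : ℝ≥0 → ℝ≥0 → Ω → ℝ) (S : Ω → ℝ≥0) (s : ℝ≥0) (ω : Ω) : ℝ≥0 → ℝ :=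
  fun t => W (S ω + s) t ω - W (S ω) t ω

/-- `σ{W(S + s, •) - W(S, •)}`, the σ-algebra generated by the random function
`W(S + s, •) - W(S, •)` for one fixed `s`. -/
def sheetIncrementSigmaAlgebra (W : ℝ≥0 → ℝ≥0 → Ω → ℝ) (S : Ω → ℝ≥0) (s : ℝ≥0) :
    MeasurableSpace Ω :=
  MeasurableSpace.comap (sheetIncrement W S s) MeasurableSpace.pi

/-- The germ σ-algebra at `S` of the function-valued process `s ↦ W(S + s, •) - W(S, •)`:
the intersection over rational `δ > 0` of `σ{W(S + u, •) - W(S, •); u ∈ [0, δ)}`. -/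
def sheetGermSigmaAlgebra (W : ℝ≥0 → ℝ≥0 → Ω → ℝ) (S : Ω → ℝ≥0) : MeasurableSpace Ω :=
  ⨅ (δ : ℚ≥0) (_ : 0 < δ), ⨆ (u : ℝ≥0) (_ : u < (δ : ℝ≥0)), sheetIncrementSigmaAlgebra W S u

/-- The intersection over rational `s > 0` of `σ{W(S + s, •) - W(S, •)}`, where each σ-algebra is
generated by a single increment. -/
def sheetIncrementInterSigmaAlgebra (W : ℝ≥0 → ℝ≥0 → Ω → ℝ) (S : Ω → ℝ≥0) : MeasurableSpace Ω :=
  ⨅ (s : ℚ≥0) (_ : 0 < s), sheetIncrementSigmaAlgebra W S (s : ℝ≥0)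

/-- A σ-algebra `m` is trivial under `P` if each of its sets is `P`-null or has `P`-null
complement. (For a probability measure and `P`-measurable sets: has probability `0` or `1`.) -/
def IsTrivialSigmaAlgebra (m : MeasurableSpace Ω) {mΩ : MeasurableSpace Ω} (P : Measure Ω) : Prop :=
  ∀ A : Set Ω, MeasurableSet[m] A → P A = 0 ∨ P Aᶜ = 0

end Germ

open Filter Topology

namespace ProbabilityTheory

variable {Ω : Type*} {mΩ : MeasurableSpace Ω} {P : Measure Ω}

/-! The increments after `S` form a new Brownian sheet (`IsBrownianSheet.sheetIncrement`), and the
germ at `S` is contained in the germ at `0` of that sheet, so Blumenthal's law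
(`measure_eq_zero_or_compl_eq_zero`) applies to it. Both results let deterministic times decrease to
a limit. For the strong Markov property, `S` is approximated from above by variables with countably
many values. Independence of the deterministic increments from the past gives each approximation the
finite-dimensional laws of `W`, and path continuity carries these over to `S`. For Blumenthal, a
germ event is independent of the increments after each `δ > 0`. As `δ → 0` it becomes independent of
the whole sheet, hence of itself. -/

/-- Two Gaussian processes with the same mean and covariance functions have the same
finite-dimensional distributions. -/
theorem IsGaussianProcess.map_restrict_eq {T : Type*} {X Y : T → Ω → ℝ}
    (hX : IsGaussianProcess X P) (hY : IsGaussianProcess Y P)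
    (hm : ∀ t, P[X t] = P[Y t]) (hc : ∀ s t, cov[X s, X t; P] = cov[Y s, Y t; P])
    (I : Finset T) :
    P.map (fun ω => I.restrict (X · ω)) = P.map (fun ω => I.restrict (Y · ω)) := by
  -- In a Euclidean space a Gaussian measure is determined by its mean and covariance form.
  apply (MeasurableEquiv.toLp 2 (_ → ℝ)).map_measurableEquiv_injective
  rw [MeasurableEquiv.coe_toLp, ← PiLp.coe_symm_continuousLinearEquiv 2 ℝ]
  have hXm : AEMeasurable (fun ω => I.restrict (X · ω)) P :=
    aemeasurable_pi_lambda _ fun _ => hX.aemeasurable _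
  have hYm : AEMeasurable (fun ω => I.restrict (Y · ω)) P :=
    aemeasurable_pi_lambda _ fun _ => hY.aemeasurable _
  have hXG := (hX.hasGaussianLaw I).isGaussian_map
  have hYG := (hY.hasGaussianLaw I).isGaussian_map
  have hP := hX.isProbabilityMeasure
  apply IsGaussian.ext
  · rw [integral_map (by fun_prop) (by fun_prop), integral_map hXm (by fun_prop),
      integral_map (by fun_prop) (by fun_prop), integral_map hYm (by fun_prop)]
    simp only [id_eq]
    rw [ContinuousLinearEquiv.integral_comp_comm, ContinuousLinearEquiv.integral_comp_comm]
    congr 1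
    ext i
    exact (eval_integral (fun i : I => (hX.hasGaussianLaw_eval i.1).integrable) i).trans
      ((hm i).trans (eval_integral (fun i : I => (hY.hasGaussianLaw_eval i.1).integrable) i).symm)
  · rw [← ContinuousLinearMap.toBilinForm_inj]
    -- By polarization, only the diagonal values of the symmetric forms need comparing.
    refine LinearMap.BilinForm.ext_of_isSymm isPosSemidef_covarianceBilin.isSymm
      isPosSemidef_covarianceBilin.isSymm fun x => ?_
    simp only [ContinuousLinearMap.toBilinForm_apply]
    rw [PiLp.coe_symm_continuousLinearEquiv,
      AEMeasurable.map_map_of_aemeasurable (by fun_prop) hXm,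
      AEMeasurable.map_map_of_aemeasurable (by fun_prop) hYm]
    refine (covarianceBilin_apply_pi (X := fun i : I => X i)
      (fun i => (hX.hasGaussianLaw_eval i.1).memLp_two) x x).trans (.trans ?_
      (covarianceBilin_apply_pi (X := fun i : I => Y i)
        (fun i => (hY.hasGaussianLaw_eval i.1).memLp_two) x x).symm)
    simp only [hc]

/-- An almost sure limit of random variables of law `μ` has law `μ`. -/
theorem hasLaw_of_ae_tendsto {E : Type*} [TopologicalSpace E]
    [TopologicalSpace.PseudoMetrizableSpace E] [MeasurableSpace E] [BorelSpace E]
    [IsProbabilityMeasure P] {μ : Measure E} {X : ℕ → Ω → E} {Z : Ω → E}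
    (hX : ∀ n, HasLaw (X n) μ P) (h : ∀ᵐ ω ∂P, Tendsto (X · ω) atTop (𝓝 (Z ω))) :
    HasLaw Z μ P := by
  have hZ : AEMeasurable Z P :=
    aemeasurable_of_tendsto_metrizable_ae' (fun n => (hX n).aemeasurable) h
  have h0 (n : ℕ) : IdentDistrib (X 0) (X n) P P :=
    ⟨(hX 0).aemeasurable, (hX n).aemeasurable, (hX 0).map_eq.trans (hX n).map_eq.symm⟩
  refine ⟨hZ, .trans ?_ (hX 0).map_eq⟩
  -- The sequence converges in distribution both to `Z` and, its law being constant, to `X 0`.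
  exact tendstoInDistribution_unique X
    (tendstoInDistribution_of_ae_tendsto (fun n => (hX n).aemeasurable) hZ h)
    (tendstoInDistribution_of_identDistrib 0 h0
      ⟨(hX 0).aemeasurable, (hX 0).aemeasurable, rfl⟩)

/-- Selecting, among random variables of law `μ`, the one with a random index `κ` gives a random
variable of law `μ` if each `X k` is independent of the event `κ = k`. -/
theorem hasLaw_of_countable_index {E : Type*} [MeasurableSpace E]
    [MeasurableSpace.CountablyGenerated E] [IsProbabilityMeasure P] {μ : Measure E}
    {X : ℕ → Ω → E} {κ : Ω → ℕ} (hX : ∀ k, HasLaw (X k) μ P)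
    (hκ : ∀ k, NullMeasurableSet (κ ⁻¹' {k}) P)
    (h : ∀ k C, MeasurableSet C → P (κ ⁻¹' {k} ∩ X k ⁻¹' C) = P (κ ⁻¹' {k}) * P (X k ⁻¹' C)) :
    HasLaw (fun ω => X (κ ω) ω) μ P := by
  have hpre (C : Set E) :
      (fun ω => X (κ ω) ω) ⁻¹' C = ⋃ k, κ ⁻¹' {k} ∩ X k ⁻¹' C := by
    ext ω; simp
  have hnull (C : Set E) (hC : MeasurableSet C) (k : ℕ) :
      NullMeasurableSet (κ ⁻¹' {k} ∩ X k ⁻¹' C) P :=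
    (hκ k).inter ((hX k).aemeasurable.nullMeasurable hC)
  have hdisj : Pairwise (Function.onFun Disjoint fun k => κ ⁻¹' {k}) := fun i j hij =>
    Set.disjoint_left.2 fun ω hi hj => hij (hi.symm.trans hj)
  have hm : AEMeasurable (fun ω => X (κ ω) ω) P := by
    refine NullMeasurable.aemeasurable fun C hC => ?_
    rw [hpre]
    exact .iUnion (hnull C hC)
  refine ⟨hm, Measure.ext fun C hC => ?_⟩
  have hsum : ∑' k, P (κ ⁻¹' {k}) = 1 := by
    rw [← measure_iUnion₀ (hdisj.mono fun _ _ h => h.aedisjoint) hκ]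
    convert measure_univ (μ := P)
    ext ω; simp
  rw [Measure.map_apply_of_aemeasurable hm hC, hpre, measure_iUnion₀ _ (hnull C hC)]
  · simp_rw [h _ _ hC, ← Measure.map_apply_of_aemeasurable (hX _).aemeasurable hC, (hX _).map_eq,
      ENNReal.tsum_mul_right, hsum, one_mul]
  · exact hdisj.mono fun i j hij =>
      (hij.mono Set.inter_subset_left Set.inter_subset_left).aedisjoint

end ProbabilityTheory

namespace IsBrownianSheet

variable {Ω : Type*} {mΩ : MeasurableSpace Ω} {P : Measure Ω} {W : ℝ≥0 → ℝ≥0 → Ω → ℝ}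

/-! ### Increments after deterministic times, the strong Markov property and the zero-one law -/

theorem aemeasurable (hW : IsBrownianSheet W P) (s t : ℝ≥0) : AEMeasurable (W s t) P :=
  hW.isGaussianProcess.aemeasurable (s, t)

theorem memLp_two (hW : IsBrownianSheet W P) (s t : ℝ≥0) : MemLp (W s t) 2 P :=
  (hW.isGaussianProcess.hasGaussianLaw_eval (s, t)).memLp_two

theorem integrable (hW : IsBrownianSheet W P) (s t : ℝ≥0) : Integrable (W s t) P :=
  (hW.isGaussianProcess.hasGaussianLaw_eval (s, t)).integrable

theorem ae_eq_zero (hW : IsBrownianSheet W P) (t : ℝ≥0) : W 0 t =ᵐ[P] 0 := by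
  have := hW.isGaussianProcess.isProbabilityMeasure
  have hv : Var[W 0 t; P] = 0 := by
    rw [← covariance_self (hW.aemeasurable 0 t), hW.covariance_eq]
    simp
  filter_upwards [ae_eq_integral_of_variance_eq_zero (hW.memLp_two 0 t) hv] with ω hω
  rw [hω, hW.integral_eq_zero]
  rfl

/-- The joint process of a Brownian sheet and its increments after `s` is Gaussian. -/
theorem isGaussianProcess_elim_increment (hW : IsBrownianSheet W P) (s : ℝ≥0) {T : Type*}
    (f : T → ℝ≥0 × ℝ≥0) :
    IsGaussianProcess (Sum.elim (fun q ω => W (f q).1 (f q).2 ω)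
      (fun (p : ℝ≥0 × ℝ≥0) ω => W (s + p.1) p.2 ω - W s p.2 ω)) P := by
  classical
  refine hW.isGaussianProcess.of_isGaussianProcess fun q => ?_
  rcases q with q | p
  · exact ⟨{f q}, ContinuousLinearMap.proj ⟨f q, by simp⟩, fun ω => rfl⟩
  · exact ⟨{(s + p.1, p.2), (s, p.2)},
      ContinuousLinearMap.proj ⟨(s + p.1, p.2), by simp⟩ -
        ContinuousLinearMap.proj ⟨(s, p.2), by simp⟩, fun ω => rfl⟩

theorem hasLaw_restrict_increment (hW : IsBrownianSheet W P) (s : ℝ≥0)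
    (I : Finset (ℝ≥0 × ℝ≥0)) :
    HasLaw (fun ω => I.restrict fun p => W (s + p.1) p.2 ω - W s p.2 ω)
      (P.map fun ω => I.restrict fun p => W p.1 p.2 ω) P := by
  have := hW.isGaussianProcess.isProbabilityMeasure
  have hG : IsGaussianProcess (fun (p : ℝ≥0 × ℝ≥0) ω => W (s + p.1) p.2 ω - W s p.2 ω) P :=
    (hW.isGaussianProcess_elim_increment s (id : ℝ≥0 × ℝ≥0 → _)).comp_right Sum.inr
  refine ⟨aemeasurable_pi_lambda _ fun p => hG.aemeasurable p.1, ?_⟩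
  refine hG.map_restrict_eq hW.isGaussianProcess (fun p => ?_) (fun p q => ?_) I
  · rw [integral_sub (hW.integrable _ _) (hW.integrable _ _)]
    simp only [hW.integral_eq_zero, sub_zero]
  · rw [covariance_fun_sub_fun_sub (hW.memLp_two _ _) (hW.memLp_two _ _) (hW.memLp_two _ _)
      (hW.memLp_two _ _)]
    simp only [hW.covariance_eq]
    push_cast
    rw [min_add_add_left, min_eq_right (le_add_of_nonneg_right p.1.coe_nonneg),
      min_eq_left (le_add_of_nonneg_right q.1.coe_nonneg), min_self]
    ring

/-- The increments of a Brownian sheet after `s` are independent of the `σ`-algebra generated by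
the sheet up to `s`. -/
theorem indep_rawSigmaAlgebra_increment (hW : IsBrownianSheet W P) (s : ℝ≥0) :
    Indep (rawSigmaAlgebra W s) (MeasurableSpace.comap
      (fun ω (p : ℝ≥0 × ℝ≥0) => W (s + p.1) p.2 ω - W s p.2 ω) MeasurableSpace.pi) P := by
  have := hW.isGaussianProcess.isProbabilityMeasure
  have hind : IndepFun (fun ω (q : Set.Iic s × ℝ≥0) => W q.1 q.2 ω)
      (fun ω (p : ℝ≥0 × ℝ≥0) => W (s + p.1) p.2 ω - W s p.2 ω) P := by
    refine IsGaussianProcess.indepFun_of_covariance_eq_zero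
      (hW.isGaussianProcess_elim_increment s fun q : Set.Iic s × ℝ≥0 => (q.1.1, q.2))
      (fun q => hW.aemeasurable _ _)
      (fun p => (hW.aemeasurable _ _).sub (hW.aemeasurable _ _)) fun q p => ?_
    rw [covariance_fun_sub_right (hW.memLp_two _ _) (hW.memLp_two _ _) (hW.memLp_two _ _)]
    simp only [hW.covariance_eq]
    have hq : (q.1.1 : ℝ) ≤ s := q.1.2
    push_cast
    -- Times `q.1 ≤ s` have the same minimum with `s + p.1` as with `s`, so the two covariances
    -- cancel.
    rw [min_eq_left hq, min_eq_left (hq.trans (by simp)), sub_self]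
  refine indep_of_indep_of_le_left hind (iSup₂_le fun r hr => iSup_le fun t => ?_)
  rintro A ⟨B, hB, rfl⟩
  have hB' : MeasurableSet B := hB
  exact ⟨(fun x => x (⟨r, hr⟩, t)) ⁻¹' B, measurable_pi_apply _ hB', rfl⟩

/-- Modifying an event by a null set preserves independence, so the completed past may replace the
raw one. -/
theorem measure_inter_increment (hW : IsBrownianSheet W P) {s : ℝ≥0} {A : Set Ω}
    (hA : MeasurableSet[completedSigmaAlgebra W P s] A) (I : Finset (ℝ≥0 × ℝ≥0))
    {C : Set (I → ℝ)} (hC : MeasurableSet C) :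
    P (A ∩ (fun ω => I.restrict fun p => W (s + p.1) p.2 ω - W s p.2 ω) ⁻¹' C) =
      P A * P ((fun ω => I.restrict fun p => W (s + p.1) p.2 ω - W s p.2 ω) ⁻¹' C) := by
  obtain ⟨A', hA', hAA'⟩ := hA
  have hAA'' : A =ᵐ[P] A' := hAA'
  rw [measure_congr hAA'']
  refine (measure_congr (hAA''.inter (ae_eq_refl _))).trans ?_
  exact (Indep_iff _ _ P).1 (hW.indep_rawSigmaAlgebra_increment s) A' _ hA'
    ⟨I.restrict ⁻¹' C, (Finset.measurable_restrict I) hC, rfl⟩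

/-- The strict inequality absorbs the right limit in the filtration: for `r < s`, `𝔉(r)` lies in
`𝔉₀(s)`. -/
theorem measurableSet_stoppingTime_lt (hW : IsBrownianSheet W P) {S : Ω → ℝ≥0}
    (hS : IsStoppingTime hW.filtration (fun ω => (S ω : WithTop ℝ≥0))) (s : ℝ≥0) :
    MeasurableSet[completedSigmaAlgebra W P s] {ω | S ω < s} := by
  obtain ⟨D, hDc, hD⟩ := TopologicalSpace.exists_countable_dense ℝ≥0
  have h : {ω | S ω < s} = ⋃ r ∈ D ∩ Set.Iio s, {ω | S ω ≤ r} := by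
    ext ω
    simp only [Set.mem_ofPred_eq, Set.mem_iUnion, exists_prop]
    constructor
    · intro hω
      obtain ⟨r, hr, h1, h2⟩ := hD.exists_between hω
      exact ⟨r, ⟨hr, h2⟩, h1.le⟩
    · rintro ⟨r, hr, h1⟩
      exact h1.trans_lt hr.2
  rw [h]
  refine MeasurableSet.biUnion (hDc.mono Set.inter_subset_left) fun r hr => ?_
  have hle : hW.filtration r ≤ completedSigmaAlgebra W P s := iInf₂_le s hr.2
  refine hle _ ?_
  simpa only [WithTop.coe_le_coe] using hS r

/-- Strong Markov property: the increments of a Brownian sheet after a finite stopping time form a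
Brownian sheet. -/
theorem sheetIncrement (hW : IsBrownianSheet W P) {S : Ω → ℝ≥0}
    (hS : IsStoppingTime hW.filtration (fun ω => (S ω : WithTop ℝ≥0))) :
    IsBrownianSheet (fun u t ω => sheetIncrement W S u ω t) P := by
  have := hW.isGaussianProcess.isProbabilityMeasure
  -- `T n k` is the right endpoint of the half-open cell `κ n = k` of `S`, so that this event is
  -- known by time `T n k`.
  let T (n k : ℕ) : ℝ≥0 := (k + 1 : ℝ≥0) / (n + 1)
  let κ (n : ℕ) (ω : Ω) : ℕ := ⌊(n + 1) * S ω⌋₊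
  have hκ (n k : ℕ) : MeasurableSet[completedSigmaAlgebra W P (T n k)] (κ n ⁻¹' {k}) := by
    have hset : κ n ⁻¹' {k} = {ω | S ω < T n k} \ {ω | S ω < (k : ℝ≥0) / (n + 1)} := by
      ext ω
      have hn : (0 : ℝ≥0) < n + 1 := by positivity
      simp only [κ, T, Set.mem_preimage, Set.mem_singleton_iff, Set.mem_sdiff, Set.mem_ofPred_eq,
        not_lt, Nat.floor_eq_iff zero_le, lt_div_iff₀ hn, mul_comm]
      exact and_comm
    rw [hset]
    refine (hW.measurableSet_stoppingTime_lt hS _).diff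
      (completedSigmaAlgebra_mono W P ?_ _ (hW.measurableSet_stoppingTime_lt hS _))
    simp only [T]
    gcongr
    simp
  have hT (ω : Ω) : Tendsto (fun n => T n (κ n ω)) atTop (𝓝 (S ω)) := by
    have hlim : Tendsto (fun n : ℕ => S ω + 1 / ((n : ℝ≥0) + 1)) atTop (𝓝 (S ω)) := by
      simpa using tendsto_const_nhds.add (tendsto_one_div_add_atTop_nhds_zero_nat (𝕜 := ℝ≥0))
    refine tendsto_of_tendsto_of_tendsto_of_le_of_le tendsto_const_nhds hlim
      (fun n => ?_) (fun n => ?_)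
    · have hn : (0 : ℝ≥0) < n + 1 := by positivity
      simp only [T, κ, le_div_iff₀ hn, mul_comm (S ω)]
      exact (Nat.lt_floor_add_one _).le
    · have hn : (0 : ℝ≥0) < n + 1 := by positivity
      simp only [T, κ, add_div]
      gcongr
      rw [div_le_iff₀ hn, mul_comm (S ω)]
      exact Nat.floor_le zero_le
  have hlaw (I : Finset (ℝ≥0 × ℝ≥0)) :
      HasLaw (fun ω => I.restrict fun p => _root_.sheetIncrement W S p.1 ω p.2)
        (P.map fun ω => I.restrict fun p => W p.1 p.2 ω) P := by
    refine hasLaw_of_ae_tendsto (X := fun n ω => I.restrict fun p =>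
      W (T n (κ n ω) + p.1) p.2 ω - W (T n (κ n ω)) p.2 ω) (fun n => ?_) ?_
    · refine hasLaw_of_countable_index
        (X := fun k ω => I.restrict fun p => W (T n k + p.1) p.2 ω - W (T n k) p.2 ω)
        (fun k => hW.hasLaw_restrict_increment _ I)
        (fun k => hW.completedSigmaAlgebra_le _ _ (hκ n k))
        fun k C hC => hW.measure_inter_increment (hκ n k) I hC
    · filter_upwards [hW.continuous_paths] with ω hω
      refine tendsto_pi_nhds.2 fun p => ?_
      have h1 : Tendsto (fun n => (T n (κ n ω) + p.1.1, p.1.2)) atTop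
          (𝓝 (S ω + p.1.1, p.1.2)) :=
        ((hT ω).add tendsto_const_nhds).prodMk_nhds tendsto_const_nhds
      have h2 : Tendsto (fun n => (T n (κ n ω), p.1.2)) atTop (𝓝 (S ω, p.1.2)) :=
        (hT ω).prodMk_nhds tendsto_const_nhds
      exact ((hω.tendsto _).comp h1).sub ((hω.tendsto _).comp h2)
  have hWm (I : Finset (ℝ≥0 × ℝ≥0)) :
      AEMeasurable (fun ω => I.restrict fun p => W p.1 p.2 ω) P :=
    aemeasurable_pi_lambda _ fun p => hW.aemeasurable _ _
  have hlawW (I : Finset (ℝ≥0 × ℝ≥0)) : HasLaw (fun ω => I.restrict fun p => W p.1 p.2 ω)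
      (P.map fun ω => I.restrict fun p => W p.1 p.2 ω) P := ⟨hWm I, rfl⟩
  -- Gaussianity, means and covariances depend only on finite-dimensional laws.
  refine ⟨⟨fun I => ⟨?_⟩⟩, fun s t => ?_, fun s t s' t' => ?_, ?_⟩
  · rw [(hlaw I).map_eq]
    exact (hW.isGaussianProcess.hasGaussianLaw I).isGaussian_map
  · let f : ((({(s, t)} : Finset (ℝ≥0 × ℝ≥0)) : Type) → ℝ) → ℝ := fun x => x ⟨(s, t), by simp⟩
    have hf : Measurable f := measurable_pi_apply _
    exact ((hlaw {(s, t)}).integral_comp (f := f) hf.aestronglyMeasurable).trans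
      (((hlawW {(s, t)}).integral_comp (f := f) hf.aestronglyMeasurable).symm.trans
        (hW.integral_eq_zero s t))
  · classical
    let I : Finset (ℝ≥0 × ℝ≥0) := {(s, t), (s', t')}
    let f : (I → ℝ) → ℝ := fun x => x ⟨(s, t), by simp [I]⟩
    let g : (I → ℝ) → ℝ := fun x => x ⟨(s', t'), by simp [I]⟩
    have hf : Measurable f := measurable_pi_apply _
    have hg : Measurable g := measurable_pi_apply _
    exact ((hlaw I).covariance_comp hf.aemeasurable hg.aemeasurable).trans
      (((hlawW I).covariance_comp hf.aemeasurable hg.aemeasurable).symm.trans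
        (hW.covariance_eq s t s' t'))
  · filter_upwards [hW.continuous_paths] with ω hω
    have h1 : Continuous fun p : ℝ≥0 × ℝ≥0 => (S ω + p.1, p.2) := by fun_prop
    have h2 : Continuous fun p : ℝ≥0 × ℝ≥0 => (S ω, p.2) := by fun_prop
    exact (hω.comp h1).sub (hω.comp h2)

/-- Blumenthal's zero-one law for the Brownian sheet. -/
theorem measure_eq_zero_or_compl_eq_zero (hW : IsBrownianSheet W P) {A : Set Ω}
    (hA : ∀ s, 0 < s → MeasurableSet[rawSigmaAlgebra W s] A) : P A = 0 ∨ P Aᶜ = 0 := by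
  have := hW.isGaussianProcess.isProbabilityMeasure
  have hA0 : NullMeasurableSet A P := hW.rawSigmaAlgebra_le 1 A (hA 1 one_pos)
  -- With the indicator, independence becomes a product law for a pair, which survives almost sure
  -- limits.
  let X : Ω → ℝ := A.indicator 1
  have hX : AEMeasurable X P := aemeasurable_one.indicator₀ hA0
  let δ (n : ℕ) : ℝ≥0 := 1 / (n + 1)
  have hδ : Tendsto δ atTop (𝓝 0) := tendsto_one_div_add_atTop_nhds_zero_nat
  have hδ0 (n : ℕ) : 0 < δ n := by positivity
  have hXW : IndepFun X (fun ω (p : ℝ≥0 × ℝ≥0) => W p.1 p.2 ω) P := by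
    refine IndepFun.indepFun_process₀ hX (fun p => hW.aemeasurable _ _) fun I => ?_
    have hWI : HasLaw (fun ω => I.restrict fun p => W p.1 p.2 ω)
        (P.map fun ω => I.restrict fun p => W p.1 p.2 ω) P :=
      ⟨aemeasurable_pi_lambda _ fun p => hW.aemeasurable _ _, rfl⟩
    have hXl : HasLaw X (P.map X) P := ⟨hX, rfl⟩
    refine (indepFun_iff_hasLaw_prodMk_prod hXl hWI).2 (hasLaw_of_ae_tendsto
      (X := fun n ω => (X ω, I.restrict fun p => W (δ n + p.1) p.2 ω - W (δ n) p.2 ω))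
      (fun n => ?_) ?_)
    · refine (indepFun_iff_hasLaw_prodMk_prod hXl (hW.hasLaw_restrict_increment _ I)).1 ?_
      refine indep_of_indep_of_le_left (indep_of_indep_of_le_right
        (hW.indep_rawSigmaAlgebra_increment (δ n)) ?_) ?_
      · rintro _ ⟨C, hC, rfl⟩
        exact ⟨I.restrict ⁻¹' C, (Finset.measurable_restrict I) hC, rfl⟩
      · exact Measurable.comap_le (@Measurable.indicator Ω ℝ A 1 (rawSigmaAlgebra W (δ n)) _ _
          (@measurable_one ℝ Ω _ (rawSigmaAlgebra W (δ n)) _) (hA _ (hδ0 n)))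
    -- The subtracted term `W (δ n)` tends to `W 0`, which vanishes almost surely.
    · have hz : ∀ᵐ ω ∂P, ∀ p : I, W 0 p.1.2 ω = 0 :=
        ae_all_iff.2 fun p => hW.ae_eq_zero p.1.2
      filter_upwards [hW.continuous_paths, hz] with ω hω hz
      refine tendsto_const_nhds.prodMk_nhds (tendsto_pi_nhds.2 fun p => ?_)
      have h1 : Tendsto (fun n => (δ n + p.1.1, p.1.2)) atTop (𝓝 (0 + p.1.1, p.1.2)) :=
        (hδ.add tendsto_const_nhds).prodMk_nhds tendsto_const_nhds
      have h2 : Tendsto (fun n => (δ n, p.1.2)) atTop (𝓝 (0, p.1.2)) :=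
        hδ.prodMk_nhds tendsto_const_nhds
      simpa [hz p] using ((hω.tendsto _).comp h1).sub ((hω.tendsto _).comp h2)
  have hle : rawSigmaAlgebra W 1 ≤
      MeasurableSpace.comap (fun ω (p : ℝ≥0 × ℝ≥0) => W p.1 p.2 ω) MeasurableSpace.pi := by
    refine iSup₂_le fun r _ => iSup_le fun t => ?_
    rintro _ ⟨B, hB, rfl⟩
    have hB' : MeasurableSet B := hB
    exact ⟨(fun x => x (r, t)) ⁻¹' B, measurable_pi_apply _ hB', rfl⟩
  have hAX : MeasurableSet[MeasurableSpace.comap X inferInstance] A := by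
    refine ⟨{1}, measurableSet_singleton 1, ?_⟩
    ext ω
    by_cases hω : ω ∈ A <;> simp [X, hω]
  have hmul : P (A ∩ A) = P A * P A := (Indep_iff _ _ P).1 hXW A A hAX (hle _ (hA 1 one_pos))
  rw [Set.inter_self] at hmul
  rcases eq_or_ne (P A) 0 with h0 | h0
  · exact .inl h0
  · refine .inr ((prob_compl_eq_zero_iff₀ hA0).2 ?_)
    exact (ENNReal.mul_right_inj h0 (measure_ne_top P A)).1 (by rw [← hmul, mul_one])

end IsBrownianSheet

section Germ

variable {Ω : Type*}

theorem sheetGermSigmaAlgebra_le_rawSigmaAlgebra (W : ℝ≥0 → ℝ≥0 → Ω → ℝ) (S : Ω → ℝ≥0) {s : ℝ≥0}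
    (hs : 0 < s) : sheetGermSigmaAlgebra W S ≤
      IsBrownianSheet.rawSigmaAlgebra (fun u t ω => sheetIncrement W S u ω t) s := by
  obtain ⟨n, hn⟩ := exists_nat_one_div_lt hs
  refine (iInf₂_le (1 / ((n : ℚ≥0) + 1)) (by positivity)).trans (iSup₂_le fun u hu => ?_)
  have hus : u ≤ s := by
    push_cast at hu
    exact (hu.trans hn).le
  refine le_trans (le_of_eq ?_) (le_iSup₂_of_le u hus le_rfl)
  simp only [sheetIncrementSigmaAlgebra, MeasurableSpace.pi, MeasurableSpace.comap_iSup,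
    MeasurableSpace.comap_comp]
  rfl

theorem sheetIncrementInterSigmaAlgebra_le_sheetGermSigmaAlgebra (W : ℝ≥0 → ℝ≥0 → Ω → ℝ)
    (S : Ω → ℝ≥0) : sheetIncrementInterSigmaAlgebra W S ≤ sheetGermSigmaAlgebra W S := by
  refine le_iInf₂ fun δ hδ => ?_
  -- The germ uses only `u < δ`, so the single increment is taken at `δ / 2`.
  have h : ((δ / 2 : ℚ≥0) : ℝ≥0) < (δ : ℝ≥0) := by
    exact_mod_cast half_lt_self hδ
  exact (iInf₂_le (δ / 2) (half_pos hδ)).trans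
    (le_iSup₂_of_le (f := fun u (_ : u < (δ : ℝ≥0)) => sheetIncrementSigmaAlgebra W S u) _ h le_rfl)

end Germ

theorem corollary2p3 {Ω : Type*} {mΩ : MeasurableSpace Ω} {P : Measure Ω}
    {W : ℝ≥0 → ℝ≥0 → Ω → ℝ} (hW : IsBrownianSheet W P)
    (S : Ω → ℝ≥0) (hS : IsStoppingTime hW.filtration (fun ω => (S ω : WithTop ℝ≥0))) :
    IsTrivialSigmaAlgebra (sheetGermSigmaAlgebra W S) P ∧
      IsTrivialSigmaAlgebra (sheetIncrementInterSigmaAlgebra W S) P := by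
  have h : IsTrivialSigmaAlgebra (sheetGermSigmaAlgebra W S) P := fun A hA =>
    (hW.sheetIncrement hS).measure_eq_zero_or_compl_eq_zero fun _ hs =>
      sheetGermSigmaAlgebra_le_rawSigmaAlgebra W S hs A hA
  exact ⟨h, fun A hA => h A (sheetIncrementInterSigmaAlgebra_le_sheetGermSigmaAlgebra W S A hA)⟩
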